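/- For real $0<q<1$ let $(a,q)_\infty=\prod_{n=0}^{\infty}(1-aq^n)$, let $B_k(x)$ denote the Bernoulli polynomials, defined by $\frac{t e^{xt}}{e^t-1}=\sum_{k\ge 0}\frac{B_k(x)}{k!}t^k$, and let $\zeta$ be the Riemann zeta function. Then for every real $x>0$ the product $(q^x,q)_\infty$ converges for every $0<q<1$ and has, as $q\to1^-$, the complete asymptotic expansion $$(q^x,q)_\infty \sim \frac{\sqrt{2\pi}}{\Gamma(x)}\Bigl(\log\frac1q\Bigr)^{\frac12-x}\prod_{\substack{k=0\\k\ne1}}^{\infty}\exp\Bigl(\frac{\zeta(2-k)}{k!}B_k(x)(\log q)^{k-1}\Bigr),$$ which means that for every integer $N\ge 0$ $$(q^x,q)_\infty = \frac{\sqrt{2\pi}}{\Gamma(x)}\Bigl(\log\frac1q\Bigr)^{\frac12-x}\prod_{\substack{0\le k\le N\\k\ne1}}\exp\Bigl(\frac{\zeta(2-k)}{k!}B_k(x)(\log q)^{k-1}\Bigr)\cdot\Bigl(1+O\bigl((\log q)^{N}\bigr)\Bigr)\qquad(q\to1^-),$$ where the implied constant may depend on $x$ and $N$. In particular, at $x=1$,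 the Euler function satisfies Watson's asymptotic formula $$(q,q)_\infty\sim\sqrt{\frac{2\pi}{\log(1/q)}}\;e^{\frac{\pi^2}{6\log q}}\,q^{-\frac1{24}}\qquad(q\to1^-),$$ in the sense that the ratio of the two sides tends to $1$, and in fact the ratio is $1+O\bigl((\log q)^N\bigr)$ for every $N\ge0$. -/

import Mathlib

open Filter Topology Asymptotics

/-- The q-Pochhammer symbol `(a, q)_∞ = ∏_{n ≥ 0} (1 - a q ^ n)`. -/
noncomputable def qPochhammer (a q : ℝ) : ℝ :=
  ∏' n : ℕ, (1 - a * q ^ n)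

/-- The value of the Riemann zeta function at an integer, as a real number. -/
noncomputable def zetaInt (n : ℤ) : ℝ :=
  (riemannZeta (n : ℂ)).re

/-- At every integer `2 - k` with `k ≠ 1` the zeta value is real, so that taking the real part
in `zetaInt` loses nothing. -/
theorem zetaInt_two_sub (k : ℕ) (hk : k ≠ 1) :
    ((zetaInt (2 - (k : ℤ)) : ℝ) : ℂ) = riemannZeta (2 - (k : ℂ)) := by
  have key : ∃ r : ℝ, riemannZeta (2 - (k : ℂ)) = (r : ℂ) := by
    rcases k with _ | _ | m
    · exact ⟨Real.pi ^ 2 / 6, by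
        simp only [Nat.cast_zero, sub_zero, riemannZeta_two]
        push_cast
        rfl⟩
    · exact absurd rfl hk
    · refine ⟨(-1) ^ m * (bernoulli (m + 1) : ℚ) / (m + 1), ?_⟩
      have h : (2 : ℂ) - ((m + 1 + 1 : ℕ) : ℂ) = -(m : ℂ) := by
        push_cast
        ring
      rw [h, riemannZeta_neg_nat_eq_bernoulli]
      push_cast
      rfl
  obtain ⟨r, hr⟩ := key
  unfold zetaInt
  push_cast
  rw [hr, Complex.ofReal_re]

/-- The asymptotic expansion truncated at `k = N`:
`√(2π) / Γ(x) * (log (1/q)) ^ (1/2 - x) * ∏_{0 ≤ k ≤ N, k ≠ 1} exp (ζ(2-k) / k! * B_k(x) * (log q) ^ (k-1))`.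
Here `bernoulliFun k x` is the value at `x` of the `k`-th Bernoulli polynomial, and the last power
is an integer power (it is `(log q)⁻¹` for `k = 0`). -/
noncomputable def qPochhammerExpansion (N : ℕ) (x q : ℝ) : ℝ :=
  Real.sqrt (2 * Real.pi) / Real.Gamma x * Real.log (1 / q) ^ (1 / 2 - x) *
    ∏ k ∈ (Finset.range (N + 1)).erase 1,
      Real.exp (zetaInt (2 - (k : ℤ)) / (k.factorial : ℝ) * bernoulliFun k x *
        Real.log q ^ ((k : ℤ) - 1))

/-- Watson's approximation `√(2π / log (1/q)) * exp (π² / (6 log q)) * q ^ (-1/24)` to the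
Euler function `(q, q)_∞`. -/
noncomputable def watsonApprox (q : ℝ) : ℝ :=
  Real.sqrt (2 * Real.pi / Real.log (1 / q)) * Real.exp (Real.pi ^ 2 / (6 * Real.log q)) *
    q ^ (-(1 / 24) : ℝ)

/-! Put q = e^(-t). Expanding every logarithm gives -log (q^x, q)_∞ = ∑_{k≥1} (1/k) e^(-xkt) / (1 -
e^(-kt)). With the Binet kernel g(s) = (e^(-xs)/(1 - e^(-s)) - 1/s - (1/2 - x) e^(-s)) / s this
becomes π²/(6t) - (1/2 - x) log(1 - e^(-t)) + t ∑_{k≥1} g(kt) (`hasSum_log_one_sub_exp`). The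
subtracted terms make g smooth at 0, while e^(-s), rather than a constant, keeps it of size 1/s² at
infinity.

Euler–Maclaurin (`eulerMaclaurin_Ioi`) expands t ∑ g(kt) in powers of t around ∫ g, with the Taylor
coefficients of g at 0, which are Bernoulli polynomial values plus multiples of 1/2 - x. The latter
cancel against the Taylor series of log((1 - e^(-t))/t), so only log t survives beside the Bernoulli
terms (`log_qPochhammer_expansion`). The integral is log Γ(x) - log(2π)/2, by Bohr–Mollerup and a
duplication identity (`binetIntegral_eq`).

Exponentiating turns the additive error O(t^(n+1)) into a relative one. At x = 1 every term with k ≥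
3 vanishes, which gives Watson's formula. -/

/-! ### Euler–Maclaurin summation and Taylor's inequality. -/

open MeasureTheory Set in
/-- Euler–Maclaurin summation on the unit interval, for a function with a chain of derivatives. -/
theorem eulerMaclaurin_unit {f : ℕ → ℝ → ℂ}
    (hf : ∀ j s, HasDerivAt (f j) (f (j + 1) s) s) (n : ℕ) :
    f 0 1 - ∫ s in (0 : ℝ)..1, f 0 s =
      ∑ j ∈ Finset.range (n + 1),
        (((bernoulli' (j + 1) : ℚ) : ℂ) / ((j + 1).factorial : ℂ)) * (f j 1 - f j 0) +
      (-1) ^ n * ∫ s in (0 : ℝ)..1,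
        ((bernoulliFun (n + 1) s / ((n + 1).factorial : ℝ) : ℝ) : ℂ) * f (n + 1) s := by
  have hcont (j : ℕ) : Continuous (f j) :=
    continuous_iff_continuousAt.2 fun s => (hf j s).continuousAt
  have hβ (k : ℕ) (s : ℝ) : HasDerivAt
      (fun s => ((bernoulliFun (k + 1) s / ((k + 1).factorial : ℝ) : ℝ) : ℂ))
      ((bernoulliFun k s / (k.factorial : ℝ) : ℝ) : ℂ) s := by
    refine HasDerivAt.ofReal_comp ?_
    refine ((hasDerivAt_bernoulliFun (k + 1) s).div_const _).congr_deriv ?_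
    rw [Nat.factorial_succ]
    push_cast
    field_simp
  have hβc (k : ℕ) : Continuous
      (fun s => ((bernoulliFun k s / (k.factorial : ℝ) : ℝ) : ℂ)) :=
    Complex.continuous_ofReal.comp ((continuous_bernoulliFun k).div_const _)
  have hparts (k j : ℕ) := intervalIntegral.integral_mul_deriv_eq_deriv_mul
    (a := 0) (b := 1) (fun s _ => hβ k s) (fun s _ => hf j s)
    ((hβc k).intervalIntegrable _ _) ((hcont (j + 1)).intervalIntegrable _ _)
  induction n with
  | zero =>
    have h := hparts 0 0
    simp only [zero_add, bernoulliFun_one, Nat.factorial, bernoulliFun_zero] at h ⊢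
    norm_num at h ⊢
    rw [h]
    ring
  | succ n ih =>
    rw [ih, Finset.sum_range_succ _ (n + 1), add_assoc]
    congr 1
    have h := hparts (n + 1) (n + 1)
    have e1 : bernoulliFun (n + 1 + 1) 1 = bernoulli' (n + 1 + 1) := by
      rw [bernoulliFun, Polynomial.eval_one_map, Polynomial.bernoulli_eval_one]; simp
    have e0 : bernoulliFun (n + 1 + 1) 0 = bernoulli' (n + 1 + 1) := by
      rw [← bernoulliFun_endpoints_eq_of_ne_one (by omega), e1]
    rw [e1, e0] at h
    -- The alternating sign from repeated integration by parts is harmless: for odd n the index n +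
    -- 2 is odd and at least 3, so the Bernoulli number vanishes.
    have key : (-1 : ℂ) ^ n * ((bernoulli' (n + 1 + 1) : ℚ) : ℂ)
        = ((bernoulli' (n + 1 + 1) : ℚ) : ℂ) := by
      rcases Nat.even_or_odd n with hn | hn
      · simp [hn.neg_one_pow]
      · rw [bernoulli'_eq_zero_of_odd (by simpa [Nat.odd_add_one, parity_simps] using hn) (by omega)]
        simp
    rw [h, pow_succ]
    push_cast
    linear_combination ((f (n + 1) 1 - f (n + 1) 0) / ((n + 1 + 1).factorial : ℂ)) * key

open MeasureTheory Set in
/-- Euler–Maclaurin summation on one interval of length `t`, with an explicit remainder. -/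
theorem eulerMaclaurin_step {f : ℕ → ℝ → ℂ}
    (hf : ∀ j s, HasDerivAt (f j) (f (j + 1) s) s) (n : ℕ) :
    ∃ B : ℝ, 0 ≤ B ∧ ∀ t a : ℝ, 0 < t →
      ‖t * f 0 (a + t) - (∫ s in a..(a + t), f 0 s) -
        ∑ j ∈ Finset.range (n + 1), (((bernoulli' (j + 1) : ℚ) : ℂ) / ((j + 1).factorial : ℂ)) *
          t ^ (j + 1) * (f j (a + t) - f j a)‖ ≤
      B * t ^ (n + 1) * ∫ s in a..(a + t), ‖f (n + 1) s‖ := by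
  have hcont (j : ℕ) : Continuous (f j) :=
    continuous_iff_continuousAt.2 fun s => (hf j s).continuousAt
  have hβc : Continuous (fun s => bernoulliFun (n + 1) s / ((n + 1).factorial : ℝ)) :=
    (continuous_bernoulliFun _).div_const _
  obtain ⟨B, hB⟩ := isCompact_Icc.exists_bound_of_continuousOn (s := Icc (0 : ℝ) 1)
    hβc.continuousOn
  have hB0 : 0 ≤ B := (norm_nonneg _).trans (hB 0 (by simp))
  refine ⟨B, hB0, fun t a ht => ?_⟩
  -- Rescaling to the unit interval: each derivative brings out one factor t.
  have hg (j : ℕ) (s : ℝ) : HasDerivAt (fun s : ℝ => (t : ℂ) ^ j * f j (a + t * s))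
      ((t : ℂ) ^ (j + 1) * f (j + 1) (a + t * s)) s := by
    have h1 : HasDerivAt (fun s : ℝ => a + t * s) t s := by
      simpa using ((hasDerivAt_id s).const_mul t).const_add a
    have h2 := ((hf j (a + t * s)).scomp s h1).const_mul ((t : ℂ) ^ j)
    refine h2.congr_deriv ?_
    rw [Complex.real_smul]
    ring
  have h := eulerMaclaurin_unit (f := fun j s => (t : ℂ) ^ j * f j (a + t * s)) hg n
  have hint : ∫ s in a..(a + t), f 0 s = t * ∫ s in (0 : ℝ)..1, f 0 (a + t * s) := by
    rw [intervalIntegral.integral_comp_add_mul (f 0) ht.ne' a]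
    simp [ht.ne']
  have hintn : ∫ s in a..(a + t), ‖f (n + 1) s‖ =
      t * ∫ s in (0 : ℝ)..1, ‖f (n + 1) (a + t * s)‖ := by
    rw [intervalIntegral.integral_comp_add_mul (fun s => ‖f (n + 1) s‖) ht.ne' a]
    simp [ht.ne']
  simp only [pow_zero, one_mul, mul_one, mul_zero, add_zero] at h
  have hrem : ‖∫ s in (0 : ℝ)..1, ((bernoulliFun (n + 1) s / ((n + 1).factorial : ℝ) : ℝ) : ℂ) *
      ((t : ℂ) ^ (n + 1) * f (n + 1) (a + t * s))‖ ≤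
      ∫ s in (0 : ℝ)..1, B * t ^ (n + 1) * ‖f (n + 1) (a + t * s)‖ := by
    refine intervalIntegral.norm_integral_le_of_norm_le zero_le_one ?_ ?_
    · refine Filter.Eventually.of_forall fun s hs => ?_
      rw [norm_mul, norm_mul, norm_pow, Complex.norm_real, Complex.norm_real,
        Real.norm_of_nonneg ht.le, mul_assoc]
      exact mul_le_mul_of_nonneg_right (hB s (Ioc_subset_Icc_self hs)) (by positivity)
    · have := hcont (n + 1)
      exact Continuous.intervalIntegrable (by fun_prop) _ _
  rw [intervalIntegral.integral_const_mul] at hrem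
  rw [hint, hintn]
  have e : (t : ℂ) * f 0 (a + t) - t * (∫ s in (0 : ℝ)..1, f 0 (a + t * s)) -
        ∑ j ∈ Finset.range (n + 1), (((bernoulli' (j + 1) : ℚ) : ℂ) / ((j + 1).factorial : ℂ)) *
          t ^ (j + 1) * (f j (a + t) - f j a) =
      t * ((-1) ^ n * ∫ s in (0 : ℝ)..1,
        ((bernoulliFun (n + 1) s / ((n + 1).factorial : ℝ) : ℝ) : ℂ) *
          ((t : ℂ) ^ (n + 1) * f (n + 1) (a + t * s))) := by
    rw [← mul_sub, h, mul_add, Finset.mul_sum, add_sub_right_comm, ← Finset.sum_sub_distrib,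
      Finset.sum_eq_zero, zero_add]
    intro j _
    ring
  rw [e, norm_mul, norm_mul, norm_pow, norm_neg, norm_one, one_pow, one_mul, Complex.norm_real,
    Real.norm_of_nonneg ht.le]
  calc _ ≤ t * (B * t ^ (n + 1) * ∫ s in (0 : ℝ)..1, ‖f (n + 1) (a + t * s)‖) := by gcongr
    _ = _ := by ring

open MeasureTheory Set in
/-- Euler–Maclaurin summation on the half line, for a function all of whose derivatives
decay quadratically. -/
theorem eulerMaclaurin_Ioi {f : ℕ → ℝ → ℂ}
    (hf : ∀ j s, HasDerivAt (f j) (f (j + 1) s) s)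
    (hbd : ∀ j, ∃ C : ℝ, ∀ s, 0 ≤ s → ‖f j s‖ ≤ C * (1 + s ^ 2)⁻¹) (n : ℕ) :
    ∃ B : ℝ, ∀ t : ℝ, 0 < t →
      Summable (fun k : ℕ => f 0 (t * (k + 1))) ∧
      ‖t * (∑' k : ℕ, f 0 (t * (k + 1))) - (∫ s in Ioi (0 : ℝ), f 0 s) +
        ∑ j ∈ Finset.range (n + 1), (((bernoulli' (j + 1) : ℚ) : ℂ) / ((j + 1).factorial : ℂ)) *
          t ^ (j + 1) * f j 0‖ ≤ B * t ^ (n + 1) := by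
  have hcont (j : ℕ) : Continuous (f j) :=
    continuous_iff_continuousAt.2 fun s => (hf j s).continuousAt
  have hint (j : ℕ) : IntegrableOn (f j) (Ioi 0) := by
    obtain ⟨C, hC⟩ := hbd j
    refine Integrable.mono' ((integrable_inv_one_add_sq.const_mul C).integrableOn)
      (hcont j).aestronglyMeasurable ?_
    filter_upwards [ae_restrict_mem measurableSet_Ioi] with s hs
    exact hC s (le_of_lt hs)
  have hlim (j : ℕ) : Tendsto (f j) atTop (𝓝 0) := by
    obtain ⟨C, hC⟩ := hbd j
    have h0 : Tendsto (fun s : ℝ => C * (1 + s ^ 2)⁻¹) atTop (𝓝 (C * 0)) := by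
      refine Tendsto.const_mul C (tendsto_inv_atTop_zero.comp ?_)
      exact tendsto_atTop_add_const_left _ _ (tendsto_pow_atTop two_ne_zero)
    rw [mul_zero] at h0
    refine squeeze_zero_norm' ?_ h0
    filter_upwards [eventually_ge_atTop 0] with s hs using hC s hs
  obtain ⟨B, hB0, hB⟩ := eulerMaclaurin_step hf n
  refine ⟨B * ∫ s in Ioi (0 : ℝ), ‖f (n + 1) s‖, fun t ht => ?_⟩
  have hsum : Summable (fun k : ℕ => f 0 (t * (k + 1))) := by
    obtain ⟨C, hC⟩ := hbd 0
    have hs : Summable (fun k : ℕ => |C| * (t ^ 2)⁻¹ * (1 / ((k : ℝ) + 1) ^ 2)) := by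
      refine Summable.mul_left _ ?_
      have := (summable_nat_add_iff 1).2 (Real.summable_one_div_nat_pow.2 (one_lt_two))
      simpa using this
    refine Summable.of_norm_bounded hs fun k => ?_
    refine (hC _ (by positivity)).trans ?_
    have h1 : (1 + (t * ((k : ℝ) + 1)) ^ 2)⁻¹ ≤ (t ^ 2)⁻¹ * (1 / ((k : ℝ) + 1) ^ 2) := by
      rw [one_div, ← mul_inv, ← mul_pow]
      exact inv_anti₀ (by positivity) (by linarith)
    calc _ ≤ |C| * (1 + (t * ((k : ℝ) + 1)) ^ 2)⁻¹ :=
          mul_le_mul_of_nonneg_right (le_abs_self C) (by positivity)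
      _ ≤ |C| * ((t ^ 2)⁻¹ * (1 / ((k : ℝ) + 1) ^ 2)) := by gcongr
      _ = _ := by ring
  refine ⟨hsum, ?_⟩
  have htK : Tendsto (fun K : ℕ => t * (K : ℝ)) atTop atTop :=
    tendsto_natCast_atTop_atTop.const_mul_atTop ht
  -- Adding the steps over consecutive intervals of length t telescopes the boundary terms; as K → ∞
  -- those at tK vanish by decay.
  have hfin (K : ℕ) : ‖t * (∑ k ∈ Finset.range K, f 0 (t * (k + 1))) -
        (∫ s in (0 : ℝ)..(t * K), f 0 s) -
        ∑ j ∈ Finset.range (n + 1), (((bernoulli' (j + 1) : ℚ) : ℂ) / ((j + 1).factorial : ℂ)) *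
          t ^ (j + 1) * (f j (t * K) - f j 0)‖ ≤
        B * t ^ (n + 1) * ∫ s in (0 : ℝ)..(t * K), ‖f (n + 1) s‖ := by
    induction K with
    | zero => simp
    | succ K ih =>
      have h := hB t (t * K) ht
      have e : t * (K : ℝ) + t = t * ((K : ℝ) + 1) := by ring
      rw [e] at h
      push_cast
      rw [← intervalIntegral.integral_add_adjacent_intervals
          ((hcont 0).intervalIntegrable 0 (t * K)) ((hcont 0).intervalIntegrable _ _),
        ← intervalIntegral.integral_add_adjacent_intervals
          ((hcont (n + 1)).norm.intervalIntegrable 0 (t * K))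
          ((hcont (n + 1)).norm.intervalIntegrable _ _), Finset.sum_range_succ, mul_add (t : ℂ),
        mul_add (B * t ^ (n + 1))]
      refine le_trans (le_of_eq ?_) ((norm_add_le _ _).trans (add_le_add ih h))
      congr 1
      have e2 : ∑ j ∈ Finset.range (n + 1),
          (((bernoulli' (j + 1) : ℚ) : ℂ) / ((j + 1).factorial : ℂ)) *
            t ^ (j + 1) * (f j (t * ((K : ℝ) + 1)) - f j 0) =
          ∑ j ∈ Finset.range (n + 1),
          (((bernoulli' (j + 1) : ℚ) : ℂ) / ((j + 1).factorial : ℂ)) *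
            t ^ (j + 1) * (f j (t * K) - f j 0) +
          ∑ j ∈ Finset.range (n + 1),
          (((bernoulli' (j + 1) : ℚ) : ℂ) / ((j + 1).factorial : ℂ)) *
            t ^ (j + 1) * (f j (t * ((K : ℝ) + 1)) - f j (t * K)) := by
        rw [← Finset.sum_add_distrib]
        refine Finset.sum_congr rfl fun j _ => ?_
        ring
      rw [e2]
      ring
  have hl : Tendsto (fun K : ℕ => t * (∑ k ∈ Finset.range K, f 0 (t * (k + 1))) -
        (∫ s in (0 : ℝ)..(t * K), f 0 s) -
        ∑ j ∈ Finset.range (n + 1), (((bernoulli' (j + 1) : ℚ) : ℂ) / ((j + 1).factorial : ℂ)) *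
          t ^ (j + 1) * (f j (t * K) - f j 0)) atTop
      (𝓝 (t * (∑' k : ℕ, f 0 (t * (k + 1))) - (∫ s in Ioi (0 : ℝ), f 0 s) -
        ∑ j ∈ Finset.range (n + 1), (((bernoulli' (j + 1) : ℚ) : ℂ) / ((j + 1).factorial : ℂ)) *
          t ^ (j + 1) * (0 - f j 0))) := by
    refine ((hsum.hasSum.tendsto_sum_nat.const_mul _).sub
      (intervalIntegral_tendsto_integral_Ioi 0 (hint 0) htK)).sub
      (tendsto_finsetSum _ fun j _ => ?_)
    exact (((hlim j).comp htK).sub_const _).const_mul _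
  have hr : Tendsto (fun K : ℕ => B * t ^ (n + 1) * ∫ s in (0 : ℝ)..(t * K), ‖f (n + 1) s‖) atTop
      (𝓝 (B * t ^ (n + 1) * ∫ s in Ioi (0 : ℝ), ‖f (n + 1) s‖)) :=
    (intervalIntegral_tendsto_integral_Ioi 0 (hint (n + 1)).norm htK).const_mul _
  have := le_of_tendsto_of_tendsto hl.norm hr (Eventually.of_forall hfin)
  simp only [zero_sub, mul_neg, Finset.sum_neg_distrib, sub_neg_eq_add] at this
  linarith

open Set in
/-- Taylor's inequality at the origin for a function with a chain of derivatives. -/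
theorem norm_sub_taylor_le {f : ℕ → ℝ → ℂ} (hf : ∀ j s, HasDerivAt (f j) (f (j + 1) s) s)
    (n : ℕ) : ∃ C : ℝ, ∀ t ∈ Icc (0 : ℝ) 1,
      ‖f 0 t - ∑ j ∈ Finset.range n, f j 0 * t ^ j / (j.factorial : ℂ)‖ ≤ C * t ^ n := by
  induction n generalizing f with
  | zero =>
    have hcont : Continuous (f 0) := continuous_iff_continuousAt.2 fun s => (hf 0 s).continuousAt
    obtain ⟨C, hC⟩ := isCompact_Icc.exists_bound_of_continuousOn (s := Icc (0 : ℝ) 1)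
      hcont.continuousOn
    exact ⟨C, fun t ht => by simpa using hC t ht⟩
  | succ n ih =>
    obtain ⟨C, hC⟩ := ih (f := fun j => f (j + 1)) fun j s => hf (j + 1) s
    refine ⟨C, fun t ht => ?_⟩
    have hC0 : 0 ≤ C := by simpa using (norm_nonneg _).trans (hC 1 (by simp))
    have hd (s : ℝ) : HasDerivAt
        (fun s : ℝ => f 0 s - ∑ j ∈ Finset.range (n + 1), f j 0 * s ^ j / (j.factorial : ℂ))
        (f 1 s - ∑ j ∈ Finset.range n, f (j + 1) 0 * s ^ j / (j.factorial : ℂ)) s := by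
      refine (hf 0 s).sub ?_
      have h1 : HasDerivAt
          (fun s : ℝ => ∑ j ∈ Finset.range (n + 1), f j 0 * (s : ℂ) ^ j / (j.factorial : ℂ))
          (∑ j ∈ Finset.range (n + 1), f j 0 * (j * (s : ℂ) ^ (j - 1)) / (j.factorial : ℂ)) s := by
        refine HasDerivAt.fun_sum fun j _ => ?_
        exact (((hasDerivAt_pow j (s : ℂ)).comp_ofReal).const_mul _).div_const _
      refine h1.congr_deriv ?_
      rw [Finset.sum_range_succ']
      simp only [Nat.cast_zero, zero_mul, mul_zero, zero_div, add_zero]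
      refine Finset.sum_congr rfl fun j _ => ?_
      rw [Nat.factorial_succ]
      push_cast
      have : (j.factorial : ℂ) ≠ 0 := by exact_mod_cast j.factorial_ne_zero
      have : (j : ℂ) + 1 ≠ 0 := by exact_mod_cast j.succ_ne_zero
      field_simp
    -- The mean value inequality with the derivative bounded crudely by its size at the right
    -- endpoint; the lost factor 1/(n + 1) is irrelevant.
    have := norm_image_sub_le_of_norm_deriv_le_segment' (C := C * t ^ n) (a := 0) (b := t)
      (fun s _ => (hd s).hasDerivWithinAt)
      (fun s hs => (hC s ⟨hs.1, hs.2.le.trans ht.2⟩).trans (by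
        have := hs.1
        have := hs.2.le
        gcongr)) t ⟨ht.1, le_rfl⟩
    have e0 : ∑ j ∈ Finset.range (n + 1), f j 0 * ((0 : ℝ) : ℂ) ^ j / (j.factorial : ℂ) = f 0 0 := by
      rw [Finset.sum_range_succ']
      simp
    rw [e0, sub_self, sub_zero, sub_zero] at this
    rw [pow_succ, ← mul_assoc]
    exact this

/-! ### Bernoulli generating function and Binet kernel: analyticity, Taylor coefficients, decay. -/

/-- The generating function `z e ^ (y z) / (e ^ z - 1)` of the Bernoulli polynomials at `y`, with
its removable singularity at the origin removed. -/
noncomputable def bernoulliGen (y : ℝ) (z : ℂ) : ℂ :=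
  Complex.exp (y * z) / dslope Complex.exp 0 z

/-- The Binet kernel: `(e ^ (- x z) / (1 - e ^ (-z)) - 1 / z - (1 / 2 - x) e ^ (-z)) / z`, with its
removable singularity at the origin removed. -/
noncomputable def binetKernel (x : ℝ) : ℂ → ℂ :=
  dslope (fun z => dslope (bernoulliGen (1 - x)) 0 z - (1 / 2 - x : ℝ) * Complex.exp (-1 * z)) 0

/-- The open horizontal strip `|Im z| < 4`. -/
def imStrip : Set ℂ := {z | |z.im| < 4}

theorem isOpen_imStrip : IsOpen imStrip :=
  isOpen_lt (continuous_abs.comp Complex.continuous_im) continuous_const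

theorem ofReal_mem_imStrip (s : ℝ) : (s : ℂ) ∈ imStrip := by simp [imStrip]

theorem imStrip_mem_nhds_zero : imStrip ∈ 𝓝 (0 : ℂ) :=
  isOpen_imStrip.mem_nhds (by simpa using ofReal_mem_imStrip 0)

/-- The nonzero solutions of e^z = 1 have |Im z| ≥ 2π > 4. The half-width 4 is a convenient value
below 2π that still leaves room for unit discs centred on the real axis. -/
theorem exp_ne_one_of_mem_imStrip {z : ℂ} (hz : z ∈ imStrip) (h0 : z ≠ 0) :
    Complex.exp z ≠ 1 := by
  intro h
  obtain ⟨n, hn⟩ := Complex.exp_eq_one_iff.1 h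
  have him : z.im = n * (2 * Real.pi) := by simp [hn]
  have hn0 : n ≠ 0 := by
    rintro rfl
    simp [hn] at h0
  have h1 : (1 : ℝ) ≤ |(n : ℝ)| := by exact_mod_cast Int.one_le_abs hn0
  have h2 : |z.im| < 4 := hz
  rw [him, abs_mul, abs_of_pos Real.two_pi_pos] at h2
  nlinarith [Real.pi_gt_three]

theorem dslope_exp_ne_zero {z : ℂ} (hz : z ∈ imStrip) : dslope Complex.exp 0 z ≠ 0 := by
  rcases eq_or_ne z 0 with rfl | h0
  · simp [dslope_same]
  · have h := sub_smul_dslope Complex.exp 0 z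
    intro h1
    rw [h1, smul_zero, Complex.exp_zero] at h
    exact exp_ne_one_of_mem_imStrip hz h0 (sub_eq_zero.1 h.symm)

theorem bernoulliGen_mul (y : ℝ) {z : ℂ} (hz : z ∈ imStrip) :
    bernoulliGen y z * (Complex.exp (1 * z) - 1) = z * Complex.exp (y * z) := by
  have h := sub_smul_dslope Complex.exp 0 z
  rw [sub_zero, smul_eq_mul, Complex.exp_zero] at h
  have := dslope_exp_ne_zero hz
  rw [one_mul, ← h, bernoulliGen]
  field_simp

theorem bernoulliGen_zero (y : ℝ) : bernoulliGen y 0 = 1 := by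
  simp [bernoulliGen, dslope_same]

theorem differentiableOn_bernoulliGen (y : ℝ) : DifferentiableOn ℂ (bernoulliGen y) imStrip := by
  refine DifferentiableOn.div (by fun_prop) ?_ fun z hz => dslope_exp_ne_zero hz
  exact (Complex.differentiableOn_dslope imStrip_mem_nhds_zero).2
    Complex.differentiable_exp.differentiableOn

theorem differentiableOn_binetKernel (x : ℝ) : DifferentiableOn ℂ (binetKernel x) imStrip := by
  refine (Complex.differentiableOn_dslope imStrip_mem_nhds_zero).2 (DifferentiableOn.sub ?_ ?_)
  · exact (Complex.differentiableOn_dslope imStrip_mem_nhds_zero).2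
      (differentiableOn_bernoulliGen _)
  · fun_prop

theorem analyticAt_of_differentiableOn_imStrip {F : ℂ → ℂ} (hF : DifferentiableOn ℂ F imStrip)
    {z : ℂ} (hz : z ∈ imStrip) : AnalyticAt ℂ F z :=
  hF.analyticAt (isOpen_imStrip.mem_nhds hz)

theorem hasDerivAt_iteratedDeriv_ofReal {F : ℂ → ℂ} (hF : DifferentiableOn ℂ F imStrip)
    (j : ℕ) (s : ℝ) : HasDerivAt (fun s : ℝ => iteratedDeriv j F s)
      (iteratedDeriv (j + 1) F s) s := by
  have h : AnalyticAt ℂ F s := analyticAt_of_differentiableOn_imStrip hF (ofReal_mem_imStrip s)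
  have hd : AnalyticAt ℂ (iteratedDeriv j F) s := by
    rw [iteratedDeriv_eq_iterate]
    exact h.iterated_deriv j
  rw [iteratedDeriv_succ]
  exact hd.differentiableAt.hasDerivAt.comp_ofReal

/-- Dividing out a zero at the origin shifts the Taylor coefficients. -/
theorem iteratedDeriv_dslope_zero {F : ℂ → ℂ} (hF : DifferentiableOn ℂ F imStrip) (n : ℕ) :
    (n + 1 : ℂ) * iteratedDeriv n (dslope F 0) 0 = iteratedDeriv (n + 1) F 0 := by
  have h0 : (0 : ℂ) ∈ imStrip := by simpa using ofReal_mem_imStrip 0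
  have hD : AnalyticAt ℂ (dslope F 0) 0 := analyticAt_of_differentiableOn_imStrip
    ((Complex.differentiableOn_dslope imStrip_mem_nhds_zero).2 hF) h0
  have e : F = fun z => F 0 + z * dslope F 0 z := by
    ext z
    have := sub_smul_dslope F 0 z
    rw [sub_zero, smul_eq_mul] at this
    rw [this]
    ring
  have : iteratedDeriv (n + 1) F 0 =
      iteratedDeriv (n + 1) (fun z => F 0 + z * dslope F 0 z) 0 := by rw [← e]
  rw [this, iteratedDeriv_const_add n.succ_pos,
    iteratedDeriv_fun_mul contDiffAt_fun_id hD.contDiffAt,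
    -- In Leibniz's rule only the first derivative of the factor z survives at the origin.
    Finset.sum_eq_single 1]
  · simp [iteratedDeriv_fun_id_zero]
  · intro i _ hi
    simp [iteratedDeriv_fun_id_zero, hi]
  · simp

theorem sum_choose_mul_bernoulliFun (y : ℝ) (n : ℕ) :
    ∑ k ∈ Finset.range (n + 1), ((n + 1).choose k : ℝ) * bernoulliFun k y = (n + 1) * y ^ n := by
  have h := congrArg (fun p => (Polynomial.map (algebraMap ℚ ℝ) p).eval y)
    (Polynomial.sum_bernoulli n)
  simpa [Polynomial.map_sum, Polynomial.eval_finsetSum, bernoulliFun, Polynomial.eval_smul,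
    Algebra.smul_def, add_mul] using h

/-- The Taylor coefficients of the generating function are the Bernoulli polynomials. -/
theorem iteratedDeriv_bernoulliGen (y : ℝ) (n : ℕ) :
    iteratedDeriv n (bernoulliGen y) 0 = bernoulliFun n y := by
  have h0 : (0 : ℂ) ∈ imStrip := by simpa using ofReal_mem_imStrip 0
  have hG : AnalyticAt ℂ (bernoulliGen y) 0 :=
    analyticAt_of_differentiableOn_imStrip (differentiableOn_bernoulliGen y) h0
  induction n using Nat.strong_induction_on with
  | _ n ih =>
    -- Comparing the derivatives of order n + 1 at 0 gives the recursion of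
    -- `sum_choose_mul_bernoulliFun`, which determines the n-th coefficient from the earlier ones.
    have e : (fun z => bernoulliGen y z * (Complex.exp (1 * z) - 1)) =ᶠ[𝓝 0]
        fun z => z * Complex.exp (y * z) := by
      filter_upwards [imStrip_mem_nhds_zero] with z hz using bernoulliGen_mul y hz
    have hexp (i : ℕ) : iteratedDeriv i (fun z : ℂ => Complex.exp (1 * z) - 1) 0 =
        if i = 0 then 0 else 1 := by
      rcases Nat.eq_zero_or_pos i with rfl | hi
      · simp
      · have := iteratedDeriv_const_add (f := fun z : ℂ => Complex.exp (1 * z)) (x := 0) hi (-1)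
        simp only [neg_add_eq_sub] at this
        rw [this, iteratedDeriv_cexp_const_mul]
        simp [hi.ne']
    have hR : iteratedDeriv (n + 1) (fun z : ℂ => z * Complex.exp (y * z)) 0 = (n + 1) * y ^ n := by
      rw [iteratedDeriv_fun_mul (by fun_prop) (by fun_prop), Finset.sum_eq_single 1]
      · simp [iteratedDeriv_fun_id_zero, iteratedDeriv_cexp_const_mul]
      · intro i _ hi
        simp [iteratedDeriv_fun_id_zero, hi]
      · simp
    have h := e.iteratedDeriv_eq (n + 1)
    rw [iteratedDeriv_fun_mul hG.contDiffAt (by fun_prop), hR, Finset.sum_range_succ,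
      Finset.sum_range_succ] at h
    simp only [hexp] at h
    have h1 : ∑ i ∈ Finset.range n, ((n + 1).choose i : ℂ) * iteratedDeriv i (bernoulliGen y) 0 *
        (if n + 1 - i = 0 then 0 else 1) =
        ∑ i ∈ Finset.range n, ((n + 1).choose i : ℂ) * bernoulliFun i y := by
      refine Finset.sum_congr rfl fun i hi => ?_
      rw [Finset.mem_range] at hi
      rw [ih i hi, if_neg (by omega), mul_one]
    rw [h1] at h
    have h2 := congrArg (fun r : ℝ => (r : ℂ)) (sum_choose_mul_bernoulliFun y n)
    rw [Finset.sum_range_succ] at h2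
    push_cast at h2
    simp at h h2
    have h3 : (n + 1 : ℂ) ≠ 0 := by exact_mod_cast n.succ_ne_zero
    refine mul_left_cancel₀ h3 ?_
    linear_combination h - h2

/-- The two divisions by z shift the coefficients of `bernoulliGen (1 - x)` by two and those of
e^(-z) by one; the reflection B_k(1 - x) = (-1)^k B_k(x) supplies the sign. -/
theorem iteratedDeriv_binetKernel (x : ℝ) (n : ℕ) :
    iteratedDeriv n (binetKernel x) 0 / (n.factorial : ℂ) =
      (-1) ^ n * (bernoulliFun (n + 2) x / ((n + 2).factorial : ℂ) +
        (1 / 2 - x : ℝ) / ((n + 1).factorial : ℂ)) := by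
  have h0 : (0 : ℂ) ∈ imStrip := by simpa using ofReal_mem_imStrip 0
  have hd := (Complex.differentiableOn_dslope imStrip_mem_nhds_zero).2
    (differentiableOn_bernoulliGen (1 - x))
  have h1 := iteratedDeriv_dslope_zero (F := fun z => dslope (bernoulliGen (1 - x)) 0 z -
    (1 / 2 - x : ℝ) * Complex.exp (-1 * z)) (hd.sub (by fun_prop)) n
  rw [iteratedDeriv_fun_sub (analyticAt_of_differentiableOn_imStrip hd h0).contDiffAt
    (by fun_prop), iteratedDeriv_const_mul _ (by fun_prop), iteratedDeriv_cexp_const_mul] at h1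
  have h2 := iteratedDeriv_dslope_zero (differentiableOn_bernoulliGen (1 - x)) (n + 1)
  rw [iteratedDeriv_bernoulliGen, bernoulliFun_eval_one_sub] at h2
  change _ * iteratedDeriv n (binetKernel x) 0 = _ at h1
  have h3 : (n + 1 : ℂ) ≠ 0 := by exact_mod_cast n.succ_ne_zero
  have h4 : (n + 1 + 1 : ℂ) ≠ 0 := by exact_mod_cast (n + 1).succ_ne_zero
  have h5 : (n.factorial : ℂ) ≠ 0 := by exact_mod_cast n.factorial_ne_zero
  rw [Nat.factorial_succ (n + 1), Nat.factorial_succ n]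
  push_cast at h1 h2 ⊢
  simp only [mul_zero, Complex.exp_zero, mul_one] at h1
  rw [pow_succ] at h1
  have h6 : (-1 : ℂ) ^ (n + 1 + 1) = (-1) ^ n := by ring
  rw [h6] at h2
  field_simp
  linear_combination 2 * (n + 1 + 1 : ℂ) * h1 + 2 * h2

/-- The outer `dslope` subtracts a value at the origin which is zero, because B_1(1 - x) = 1/2 - x;
this dictates the coefficient of e^(-z). The parameter 1 - x enters through e^(-xz)/(1 - e^(-z)) =
e^((1-x)z)/(e^z - 1). -/
theorem binetKernel_of_ne_zero (x : ℝ) {z : ℂ} (hz : z ∈ imStrip) (h0 : z ≠ 0) :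
    binetKernel x z = (Complex.exp (-(x * z)) / (1 - Complex.exp (-z)) - 1 / z -
      (1 / 2 - x : ℝ) * Complex.exp (-z)) / z := by
  have h1 := sub_smul_dslope (bernoulliGen (1 - x)) 0 z
  have h2 := sub_smul_dslope (fun z => dslope (bernoulliGen (1 - x)) 0 z -
    (1 / 2 - x : ℝ) * Complex.exp (-1 * z)) 0 z
  have h3 := bernoulliGen_mul (1 - x) hz
  have h4 := iteratedDeriv_bernoulliGen (1 - x) 1
  rw [iteratedDeriv_one, bernoulliFun_one] at h4
  have h5 : Complex.exp z - 1 ≠ 0 := sub_ne_zero.2 (exp_ne_one_of_mem_imStrip hz h0)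
  change _ • binetKernel x z = _ at h2
  rw [dslope_same, h4] at h2
  rw [bernoulliGen_zero] at h1
  simp only [sub_zero, smul_eq_mul, mul_zero, Complex.exp_zero, mul_one, neg_mul, one_mul]
    at h1 h2 h3
  have h6 : Complex.exp (-(x * z)) / (1 - Complex.exp (-z)) =
      Complex.exp (((1 - x : ℝ) : ℂ) * z) / (Complex.exp z - 1) := by
    have e : ((1 - x : ℝ) : ℂ) * z = -(x * z) + z := by push_cast; ring
    have h7 : (1 : ℂ) - Complex.exp (-z) = (Complex.exp z - 1) / Complex.exp z := by
      rw [Complex.exp_neg]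
      field_simp [Complex.exp_ne_zero z]
    rw [e, h7, Complex.exp_add, div_div_eq_mul_div]
  have h8 : dslope (bernoulliGen (1 - x)) 0 z =
      Complex.exp (((1 - x : ℝ) : ℂ) * z) / (Complex.exp z - 1) - 1 / z := by
    refine mul_left_cancel₀ h0 ?_
    rw [h1, eq_div_iff h5 |>.2 h3]
    field_simp
  rw [h6, eq_div_iff h0, mul_comm, h2, h8]
  push_cast
  ring

open Metric in
/-- All derivatives of the Binet kernel decay quadratically along the positive half line. -/
theorem norm_iteratedDeriv_binetKernel_le {x : ℝ} (hx : 0 < x) (j : ℕ) :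
    ∃ C : ℝ, ∀ s : ℝ, 0 ≤ s →
      ‖iteratedDeriv j (binetKernel x) (s : ℂ)‖ ≤ C * (1 + s ^ 2)⁻¹ := by
  have hsub (s : ℝ) : closedBall (s : ℂ) 1 ⊆ imStrip := by
    intro z hz
    rw [mem_closedBall_iff_norm] at hz
    have := (Complex.abs_im_le_norm (z - s)).trans hz
    simp only [Complex.sub_im, Complex.ofReal_im, sub_zero] at this
    exact lt_of_le_of_lt this (by norm_num)
  -- By Cauchy's estimate on unit circles, a bound for the kernel itself, uniform over unit discs,
  -- controls all its derivatives.
  obtain ⟨M, hM⟩ : ∃ M : ℝ, ∀ s : ℝ, 0 ≤ s → ∀ z ∈ closedBall (s : ℂ) 1,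
      ‖binetKernel x z‖ ≤ M * (1 + s ^ 2)⁻¹ := by
    have hK : IsCompact (closedBall (0 : ℂ) 3 ∩ {z | |z.im| ≤ 1}) :=
      (isCompact_closedBall _ _).inter_right
        (isClosed_le (continuous_abs.comp Complex.continuous_im) continuous_const)
    obtain ⟨M₁, hM₁⟩ := hK.exists_bound_of_continuousOn (f := binetKernel x)
      ((differentiableOn_binetKernel x).continuousOn.mono fun z hz =>
        show |z.im| < 4 from lt_of_le_of_lt hz.2 (by norm_num))
    set K : ℝ := 2 / x + 1 + |1 / 2 - x| with hKdef
    have hK0 : 0 ≤ K := by positivity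
    -- For s ≤ 2 compactness gives M₁, and 1 + s² ≤ 5. For s > 2 the three terms of the kernel add
    -- up to K / r² with r = Re z ≥ s - 1 > 1, and 1 + s² ≤ 5r².
    refine ⟨5 * |M₁| + 5 * K, fun s hs z hz => ?_⟩
    have hzS := hsub s hz
    rw [mem_closedBall_iff_norm] at hz
    have him := (Complex.abs_im_le_norm (z - s)).trans hz
    have hre := (Complex.abs_re_le_norm (z - s)).trans hz
    simp only [Complex.sub_im, Complex.ofReal_im, sub_zero, Complex.sub_re,
      Complex.ofReal_re] at him hre
    rw [abs_le] at hre
    rw [add_mul]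
    rcases le_or_gt s 2 with h2 | h2
    · have hz3 : ‖z‖ ≤ 3 := by
        calc ‖z‖ = ‖(z - s) + s‖ := by rw [sub_add_cancel]
          _ ≤ ‖z - s‖ + ‖(s : ℂ)‖ := norm_add_le _ _
          _ ≤ 1 + 2 := by
            rw [Complex.norm_real, Real.norm_of_nonneg hs]
            exact add_le_add hz h2
          _ = 3 := by norm_num
      have h3 := hM₁ z ⟨by simpa using hz3, him⟩
      have h4 : 1 ≤ 5 * (1 + s ^ 2)⁻¹ := by
        rw [← div_eq_mul_inv, le_div_iff₀ (by positivity)]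
        nlinarith
      have h5 : 0 ≤ 5 * K * (1 + s ^ 2)⁻¹ := by positivity
      nlinarith [le_abs_self M₁, abs_nonneg M₁]
    · set r := z.re with hr
      have hr1 : 1 ≤ r := by linarith
      have hr0 : 0 < r := by linarith
      have hz0 : z ≠ 0 := by
        rintro rfl
        simp at hr
        linarith
      have hrz : r ≤ ‖z‖ := Complex.re_le_norm z
      have hexp {a : ℝ} (ha : 0 < a) : Real.exp (-a) ≤ 1 / a := by
        rw [Real.exp_neg, one_div]
        exact inv_anti₀ ha (by linarith [Real.add_one_le_exp a])
      have hden : 1 / 2 ≤ ‖1 - Complex.exp (-z)‖ := by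
        have h1 : ‖Complex.exp (-z)‖ ≤ 1 / 2 := by
          rw [Complex.norm_exp, Complex.neg_re, Real.exp_neg, one_div]
          exact inv_anti₀ two_pos (by linarith [Real.add_one_le_exp r])
        have h2 := norm_sub_norm_le (1 : ℂ) (Complex.exp (-z))
        rw [norm_one] at h2
        linarith
      have hA : ‖Complex.exp (-(x * z)) / (1 - Complex.exp (-z))‖ ≤ 2 / x / r := by
        rw [norm_div, Complex.norm_exp]
        have h1 : (-(x * z)).re = -(x * r) := by simp [hr]
        rw [h1]
        calc _ ≤ (1 / (x * r)) / (1 / 2) := by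
              gcongr
              exact hexp (by positivity)
          _ = _ := by field_simp
      have hB : ‖1 / z‖ ≤ 1 / r := by
        rw [norm_div, norm_one]
        gcongr
      have hC : ‖((1 / 2 - x : ℝ) : ℂ) * Complex.exp (-z)‖ ≤ |1 / 2 - x| / r := by
        rw [norm_mul, Complex.norm_real, Real.norm_eq_abs, Complex.norm_exp, Complex.neg_re,
          div_eq_mul_one_div]
        exact mul_le_mul_of_nonneg_left (by simpa using hexp hr0) (abs_nonneg _)
      have hmain : ‖binetKernel x z‖ ≤ K / r ^ 2 := by
        rw [binetKernel_of_ne_zero x hzS hz0, norm_div]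
        calc _ ≤ (2 / x / r + 1 / r + |1 / 2 - x| / r) / r := by
              gcongr
              exact (norm_sub_le _ _).trans (add_le_add ((norm_sub_le _ _).trans
                (add_le_add hA hB)) hC)
          _ = _ := by rw [hKdef]; field_simp
      have hfin : K / r ^ 2 ≤ 5 * K * (1 + s ^ 2)⁻¹ := by
        rw [← div_eq_mul_inv, div_le_div_iff₀ (by positivity) (by positivity)]
        have : 1 + s ^ 2 ≤ 5 * r ^ 2 := by nlinarith
        nlinarith
      have : 0 ≤ 5 * |M₁| * (1 + s ^ 2)⁻¹ := by positivity
      linarith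
  refine ⟨j.factorial * M, fun s hs => ?_⟩
  have hd : DiffContOnCl ℂ (binetKernel x) (ball (s : ℂ) 1) := by
    refine DifferentiableOn.diffContOnCl ?_
    rw [closure_ball _ one_ne_zero]
    exact (differentiableOn_binetKernel x).mono (hsub s)
  refine (Complex.norm_iteratedDeriv_le_of_forall_mem_sphere_norm_le j one_pos hd
    fun z hz => hM s hs z (sphere_subset_closedBall hz)).trans (le_of_eq ?_)
  simp [mul_assoc]

/-! ### The Binet integral and its identification with log Γ. -/

/-- The Binet kernel on the positive real axis. -/
noncomputable def binetKernelReal (x s : ℝ) : ℝ :=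
  (Real.exp (-(x * s)) / (1 - Real.exp (-s)) - 1 / s - (1 / 2 - x) * Real.exp (-s)) / s

theorem binetKernel_ofReal (x : ℝ) {s : ℝ} (hs : 0 < s) :
    binetKernel x s = (binetKernelReal x s : ℂ) := by
  rw [binetKernel_of_ne_zero x (ofReal_mem_imStrip s) (by exact_mod_cast hs.ne'),
    binetKernelReal]
  push_cast
  rfl

theorem one_sub_exp_neg_pos {s : ℝ} (hs : 0 < s) : 0 < 1 - Real.exp (-s) := by
  have : Real.exp (-s) < 1 := by simpa using hs
  linarith

open MeasureTheory Set in
theorem integrableOn_binetKernelReal {x : ℝ} (hx : 0 < x) :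
    IntegrableOn (binetKernelReal x) (Ioi 0) := by
  obtain ⟨C, hC⟩ := norm_iteratedDeriv_binetKernel_le hx 0
  refine Integrable.mono' ((integrable_inv_one_add_sq.const_mul C).integrableOn) ?_ ?_
  · refine ContinuousOn.aestronglyMeasurable (fun s hs => ?_) measurableSet_Ioi
    have h1 := (one_sub_exp_neg_pos hs).ne'
    have h2 : s ≠ 0 := ne_of_gt hs
    unfold binetKernelReal
    fun_prop (disch := assumption)
  · filter_upwards [ae_restrict_mem measurableSet_Ioi] with s hs
    have h := hC s (le_of_lt hs)
    rwa [iteratedDeriv_zero, binetKernel_ofReal x hs, Complex.norm_real] at h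

/-- The factor 1 - e^(-s) cancels, leaving a Frullani integrand; this drives the functional equation
of the Binet integral. -/
theorem binetKernelReal_add_one_sub (x : ℝ) {s : ℝ} (hs : 0 < s) :
    binetKernelReal (x + 1) s - binetKernelReal x s =
      s⁻¹ • (Real.exp (-(1 * s)) - Real.exp (-(x * s))) := by
  have h1 := (one_sub_exp_neg_pos hs).ne'
  have e : Real.exp (-((x + 1) * s)) = Real.exp (-(x * s)) * Real.exp (-s) := by
    rw [← Real.exp_add]
    ring_nf
  rw [binetKernelReal, binetKernelReal, e, one_mul, smul_eq_mul]
  field_simp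
  ring

-- For a = 1 the integrand is a difference of two Binet kernels, already known to be integrable; the
-- general case is a difference of two such.
open MeasureTheory Set in
theorem integrableOn_inv_smul_exp_sub_exp {a b : ℝ} (ha : 0 < a) (hb : 0 < b) :
    IntegrableOn (fun s : ℝ => s⁻¹ • (Real.exp (-(a * s)) - Real.exp (-(b * s)))) (Ioi 0) := by
  have h {x : ℝ} (hx : 0 < x) :
      IntegrableOn (fun s : ℝ => s⁻¹ • (Real.exp (-(1 * s)) - Real.exp (-(x * s)))) (Ioi 0) :=
    ((integrableOn_binetKernelReal (by linarith : 0 < x + 1)).sub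
      (integrableOn_binetKernelReal hx)).congr_fun
      (fun s hs => binetKernelReal_add_one_sub x hs) measurableSet_Ioi
  refine ((h hb).sub (h ha)).congr_fun (fun s _ => ?_) measurableSet_Ioi
  simp only [Pi.sub_apply, smul_eq_mul]
  ring

open MeasureTheory Set in
theorem integral_inv_smul_exp_sub_exp {a b : ℝ} (ha : 0 < a) (hb : 0 < b) :
    ∫ s in Ioi (0 : ℝ), s⁻¹ • (Real.exp (-(a * s)) - Real.exp (-(b * s))) = Real.log (b / a) := by
  have hc : Continuous fun s : ℝ => Real.exp (-s) := by fun_prop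
  have h := Frullani.integral_Ioi_eq (f := fun s : ℝ => Real.exp (-s)) (L := 1) (R := 0)
    (hc.locallyIntegrable.locallyIntegrableOn _) ha hb
    (by simpa using (hc.tendsto 0).mono_left nhdsWithin_le_nhds)
    Real.tendsto_exp_neg_atTop_nhds_zero (integrableOn_inv_smul_exp_sub_exp ha hb)
  simpa using h

open MeasureTheory Set in
/-- The Binet integral, equal to `log (Γ x) - log (2 π) / 2`. -/
noncomputable def binetIntegral (x : ℝ) : ℝ := ∫ s in Ioi (0 : ℝ), binetKernelReal x s

open MeasureTheory Set in
theorem binetIntegral_add_one {x : ℝ} (hx : 0 < x) :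
    binetIntegral (x + 1) = binetIntegral x + Real.log x := by
  have h : binetIntegral (x + 1) - binetIntegral x = Real.log x := by
    rw [binetIntegral, binetIntegral, ← integral_sub
      (integrableOn_binetKernelReal (by linarith : 0 < x + 1)) (integrableOn_binetKernelReal hx),
      setIntegral_congr_fun measurableSet_Ioi (fun s hs => binetKernelReal_add_one_sub x hs),
      integral_inv_smul_exp_sub_exp one_pos hx, div_one]
  linarith

-- Pointwise in s, the kernel is convex in x: e^(-xs) is convex, the other terms are affine in x,
-- and both divisors are positive.
open MeasureTheory Set in
theorem convexOn_binetIntegral : ConvexOn ℝ (Ioi 0) binetIntegral := by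
  refine ⟨convex_Ioi 0, fun x hx y hy a b ha hb hab => ?_⟩
  have hxy : 0 < a • x + b • y := (convex_Ioi (0 : ℝ)) hx hy ha hb hab
  simp only [binetIntegral, smul_eq_mul] at hxy ⊢
  rw [← integral_const_mul, ← integral_const_mul,
    ← integral_add ((integrableOn_binetKernelReal hx).const_mul a)
      ((integrableOn_binetKernelReal hy).const_mul b)]
  refine setIntegral_mono_on (integrableOn_binetKernelReal hxy)
    (((integrableOn_binetKernelReal hx).const_mul a).add
      ((integrableOn_binetKernelReal hy).const_mul b)) measurableSet_Ioi fun s hs => ?_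
  have hs0 : 0 < s := hs
  have h1 := one_sub_exp_neg_pos hs0
  have hexp : Real.exp (-((a * x + b * y) * s)) ≤
      a * Real.exp (-(x * s)) + b * Real.exp (-(y * s)) := by
    have := convexOn_exp.2 (mem_univ (-(x * s))) (mem_univ (-(y * s))) ha hb hab
    simp only [smul_eq_mul] at this
    refine le_trans (le_of_eq ?_) this
    ring_nf
  have hb' : b = 1 - a := by linarith
  have e : a * binetKernelReal x s + b * binetKernelReal y s =
      ((a * Real.exp (-(x * s)) + b * Real.exp (-(y * s))) / (1 - Real.exp (-s)) - 1 / s -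
        (1 / 2 - (a * x + b * y)) * Real.exp (-s)) / s := by
    rw [binetKernelReal, binetKernelReal, hb']
    ring
  rw [e, binetKernelReal]
  gcongr

/-- Bohr–Mollerup: the exponential of the right side is log-convex, satisfies the functional
equation of Γ and equals 1 at x = 1. -/
theorem log_Gamma_eq_binetIntegral_sub {x : ℝ} (hx : 0 < x) :
    Real.log (Real.Gamma x) = binetIntegral x - binetIntegral 1 := by
  have h := Real.eq_Gamma_of_log_convex
    (f := fun x => Real.exp (binetIntegral x - binetIntegral 1)) ?_ ?_ ?_ ?_ hx
  · rw [← h, Real.log_exp]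
  · have e : (Real.log ∘ fun x => Real.exp (binetIntegral x - binetIntegral 1)) =
        fun x => binetIntegral x + (-binetIntegral 1) := by
      ext x
      simp [sub_eq_add_neg]
    rw [e]
    exact convexOn_binetIntegral.add_const _
  · intro y hy
    rw [binetIntegral_add_one hy, show binetIntegral y + Real.log y - binetIntegral 1 =
      Real.log y + (binetIntegral y - binetIntegral 1) by ring, Real.exp_add, Real.exp_log hy]
  · intro y _
    exact Real.exp_pos _
  · simp

-- The kernel at 1/2 is a rescaled kernel at 1, minus the kernel at 1, minus half a Frullani
-- integrand. The first two have equal integrals, so only -(log 2)/2 remains.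
open MeasureTheory Set in
theorem binetIntegral_half : binetIntegral (1 / 2) = -(Real.log 2 / 2) := by
  have e (s : ℝ) (hs : s ∈ Ioi (0 : ℝ)) : binetKernelReal (1 / 2) s =
      (1 / 2) * binetKernelReal 1 ((1 / 2) * s) - binetKernelReal 1 s -
        (1 / 2) * (s⁻¹ • (Real.exp (-((1 / 2) * s)) - Real.exp (-(1 * s)))) := by
    have hs0 : 0 < s := hs
    have h1 := (one_sub_exp_neg_pos hs0).ne'
    have h2 := (one_sub_exp_neg_pos (half_pos hs0)).ne'
    have h3 : Real.exp (-s) = Real.exp (-(s / 2)) ^ 2 := by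
      rw [← Real.exp_nat_mul]
      ring_nf
    have h4 : (1 / 2) * s = s / 2 := by ring
    simp only [binetKernelReal, one_mul, smul_eq_mul, h4]
    rw [h3] at h1 ⊢
    generalize Real.exp (-(s / 2)) = w at *
    have h5 : 1 + w ≠ 0 := by
      intro h
      apply h1
      linear_combination (1 - w) * h
    have h6 : 1 - w ^ 2 = (1 - w) * (1 + w) := by ring
    rw [h6]
    field_simp
    ring
  have i1 := integrableOn_binetKernelReal one_pos
  have i2 : IntegrableOn (fun s => (1 / 2 : ℝ) * binetKernelReal 1 ((1 / 2) * s)) (Ioi 0) := by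
    refine Integrable.const_mul ?_ _
    have := (integrableOn_Ioi_comp_mul_left_iff (binetKernelReal 1) 0
      (by norm_num : (0 : ℝ) < 1 / 2)).2 (by simpa using i1)
    exact this
  have i3 := (integrableOn_inv_smul_exp_sub_exp (half_pos one_pos) one_pos).const_mul (1 / 2)
  have i12 : IntegrableOn (fun s => (1 / 2 : ℝ) * binetKernelReal 1 ((1 / 2) * s) -
      binetKernelReal 1 s) (Ioi 0) := i2.sub i1
  rw [binetIntegral, setIntegral_congr_fun measurableSet_Ioi e, integral_sub i12 i3,
    integral_sub i2 i1, integral_const_mul, integral_const_mul,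
    integral_inv_smul_exp_sub_exp (half_pos one_pos) one_pos,
    integral_comp_mul_left_Ioi _ _ (half_pos one_pos)]
  norm_num
  ring

/-- The additive constant follows from Γ(1/2) = √π and the value of the integral at 1/2. -/
theorem binetIntegral_eq {x : ℝ} (hx : 0 < x) :
    binetIntegral x = Real.log (Real.Gamma x) - Real.log (2 * Real.pi) / 2 := by
  have h := log_Gamma_eq_binetIntegral_sub (half_pos one_pos)
  rw [Real.Gamma_one_half_eq, binetIntegral_half, Real.log_sqrt Real.pi_pos.le] at h
  rw [log_Gamma_eq_binetIntegral_sub hx, Real.log_mul two_ne_zero Real.pi_ne_zero]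
  linarith

/-! ### The logarithm of the product and its expansion in t. -/

/-- The logarithm of `(e ^ (-x t), e ^ (-t))_∞` through the Binet kernel. -/
theorem hasSum_log_one_sub_exp {x t : ℝ} (hx : 0 < x) (ht : 0 < t)
    (hs : Summable fun k : ℕ => binetKernelReal x (t * (k + 1))) :
    HasSum (fun n : ℕ => Real.log (1 - Real.exp (-((x + n) * t))))
      (-(Real.pi ^ 2 / 6 / t) + (1 / 2 - x) * Real.log (1 - Real.exp (-t)) -
        t * ∑' k : ℕ, binetKernelReal x (t * (k + 1))) := by
  have h1 : HasSum (fun k : ℕ => (1 / ((k : ℝ) + 1) ^ 2) / t) (Real.pi ^ 2 / 6 / t) := by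
    have := (hasSum_nat_add_iff' 1).2 hasSum_zeta_two
    simp only [Finset.sum_range_one, Nat.cast_zero, ne_eq, OfNat.ofNat_ne_zero,
      not_false_eq_true, zero_pow, div_zero, sub_zero] at this
    simpa using this.div_const t
  have hexp {s : ℝ} (h : 0 < s) : |Real.exp (-s)| < 1 := by
    rw [abs_of_pos (Real.exp_pos _)]
    linarith [one_sub_exp_neg_pos h]
  have h2 := (Real.hasSum_pow_div_log_of_abs_lt_one (hexp ht)).mul_left (1 / 2 - x)
  have h3 := hs.hasSum.mul_left t
  set S := Real.pi ^ 2 / 6 / t + (1 / 2 - x) * -Real.log (1 - Real.exp (-t)) +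
    t * ∑' k : ℕ, binetKernelReal x (t * (k + 1)) with hS
  -- Double series of nonnegative terms: summing over k gives -log of the n-th factor, summing over
  -- n gives a geometric series, which the definition of the kernel splits into three. Nonnegativity
  -- justifies the interchange.
  let a : ℕ → ℕ → ℝ := fun k n => Real.exp (-((x + n) * t)) ^ (k + 1) / (k + 1)
  have ha (k n : ℕ) : 0 ≤ a k n := by positivity
  have hcol (k : ℕ) : HasSum (a k) ((1 / ((k : ℝ) + 1) ^ 2) / t +
      (1 / 2 - x) * (Real.exp (-t) ^ (k + 1) / (k + 1)) +
      t * binetKernelReal x (t * (k + 1))) := by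
    have hk : (0 : ℝ) < k + 1 := by positivity
    have htk : 0 < t * (k + 1) := by positivity
    have hg := ((hasSum_geometric_of_abs_lt_one (hexp htk)).mul_left
      (Real.exp (-(x * (t * (k + 1)))))).div_const ((k : ℝ) + 1)
    have e1 : (fun n : ℕ => Real.exp (-(x * (t * (k + 1)))) * Real.exp (-(t * (k + 1))) ^ n /
        ((k : ℝ) + 1)) = a k := by
      ext n
      simp only [a]
      rw [← Real.exp_nat_mul, ← Real.exp_nat_mul, ← Real.exp_add]
      push_cast
      ring_nf
    rw [e1] at hg
    have e2 : Real.exp (-t) ^ (k + 1) = Real.exp (-(t * (k + 1))) := by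
      rw [← Real.exp_nat_mul]
      push_cast
      ring_nf
    have h1 := (one_sub_exp_neg_pos htk).ne'
    have e3 : (1 / ((k : ℝ) + 1) ^ 2) / t + (1 / 2 - x) * (Real.exp (-t) ^ (k + 1) / (k + 1)) +
        t * binetKernelReal x (t * (k + 1)) =
        Real.exp (-(x * (t * (k + 1)))) * (1 - Real.exp (-(t * (k + 1))))⁻¹ / (k + 1) := by
      rw [e2, binetKernelReal]
      field_simp
      ring
    rw [e3]
    exact hg
  have hsum : HasSum (fun k : ℕ => (1 / ((k : ℝ) + 1) ^ 2) / t +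
      (1 / 2 - x) * (Real.exp (-t) ^ (k + 1) / (k + 1)) +
      t * binetKernelReal x (t * (k + 1))) S := (h1.add h2).add h3
  have hprod : Summable fun p : ℕ × ℕ => a p.1 p.2 := by
    refine (summable_prod_of_nonneg fun p => ha p.1 p.2).2 ⟨fun k => (hcol k).summable, ?_⟩
    simp only [fun k => (hcol k).tsum_eq]
    exact hsum.summable
  have htot : HasSum (fun p : ℕ × ℕ => a p.1 p.2) S := by
    have := hprod.hasSum.prod_fiberwise hcol
    rw [hsum.unique this]
    exact hprod.hasSum
  have hswap : HasSum (fun p : ℕ × ℕ => a p.2 p.1) S :=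
    (Equiv.prodComm ℕ ℕ).hasSum_iff.2 htot
  have hrow (n : ℕ) : HasSum (fun k => a k n) (-Real.log (1 - Real.exp (-((x + n) * t)))) :=
    Real.hasSum_pow_div_log_of_abs_lt_one (hexp (by positivity))
  have := (hswap.prod_fiberwise hrow).neg
  simp only [neg_neg] at this
  have e : -(Real.pi ^ 2 / 6 / t) + (1 / 2 - x) * Real.log (1 - Real.exp (-t)) -
      t * ∑' k : ℕ, binetKernelReal x (t * (k + 1)) = -S := by
    rw [hS]
    ring
  rw [e]
  exact this

open MeasureTheory Set in
/-- Taylor expansion of `log ((1 - e ^ (-t)) / t)`. -/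
theorem log_one_sub_exp_neg_taylor (n : ℕ) : ∃ C : ℝ, ∀ t : ℝ, 0 < t → t ≤ 1 →
    |Real.log (1 - Real.exp (-t)) - Real.log t -
      ∑ j ∈ Finset.range n, (bernoulli (j + 1) : ℝ) / (j + 1) * t ^ (j + 1) /
        ((j + 1).factorial : ℝ)| ≤ C * t ^ (n + 1) := by
  set D := dslope (bernoulliGen 0) 0 with hD
  have hDd : DifferentiableOn ℂ D imStrip :=
    (Complex.differentiableOn_dslope imStrip_mem_nhds_zero).2 (differentiableOn_bernoulliGen 0)
  have hDc : Continuous fun s : ℝ => D s := continuous_iff_continuousAt.2 fun s => by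
    simpa using (hasDerivAt_iteratedDeriv_ofReal hDd 0 s).continuousAt
  -- The derivative of log((1 - e^(-s))/s) is 1/(e^s - 1) - 1/s = D s, so a primitive of D followed
  -- by the derivatives of D is the chain to which Taylor's inequality applies.
  let f : ℕ → ℝ → ℂ := fun j => Nat.casesOn j (fun t => ∫ s in (0 : ℝ)..t, D s)
    fun j t => iteratedDeriv j D t
  have hf (j : ℕ) (s : ℝ) : HasDerivAt (f j) (f (j + 1) s) s := by
    cases j with
    | zero =>
      simpa [f] using intervalIntegral.integral_hasDerivAt_right (hDc.intervalIntegrable 0 s)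
        (hDc.stronglyMeasurableAtFilter _ _) hDc.continuousAt
    | succ j => exact hasDerivAt_iteratedDeriv_ofReal hDd j s
  obtain ⟨C, hC⟩ := norm_sub_taylor_le hf (n + 1)
  refine ⟨C, fun t ht ht1 => ?_⟩
  have hh (s : ℝ) (hs : 0 < s) : HasDerivAt
      (fun s : ℝ => ((Real.log (1 - Real.exp (-s)) - Real.log s : ℝ) : ℂ)) (D s) s := by
    have h1 := one_sub_exp_neg_pos hs
    have h2 : HasDerivAt (fun s : ℝ => 1 - Real.exp (-s)) (Real.exp (-s)) s := by
      simpa using ((hasDerivAt_neg s).exp).const_sub 1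
    have h3 := ((h2.log h1.ne').sub (Real.hasDerivAt_log hs.ne')).ofReal_comp
    refine h3.congr_deriv ?_
    have hsc : (s : ℂ) ≠ 0 := by exact_mod_cast hs.ne'
    refine mul_left_cancel₀ hsc ?_
    have h4 := sub_smul_dslope (bernoulliGen 0) 0 s
    rw [sub_zero, smul_eq_mul, bernoulliGen_zero] at h4
    have h5 := bernoulliGen_mul 0 (ofReal_mem_imStrip s)
    have h6 : Complex.exp s - 1 ≠ 0 :=
      sub_ne_zero.2 (exp_ne_one_of_mem_imStrip (ofReal_mem_imStrip s) hsc)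
    simp only [one_mul, Complex.ofReal_zero, zero_mul, Complex.exp_zero, mul_one] at h5
    rw [hD, h4, eq_div_iff h6 |>.2 h5]
    have h7 : (1 : ℂ) - Complex.exp (-s) = (Complex.exp s - 1) / Complex.exp s := by
      rw [Complex.exp_neg]
      field_simp [Complex.exp_ne_zero]
    push_cast
    rw [h7, Complex.exp_neg]
    field_simp [Complex.exp_ne_zero]
  have hlim : Tendsto (fun s : ℝ => ((Real.log (1 - Real.exp (-s)) - Real.log s : ℝ) : ℂ))
      (𝓝[>] 0) (𝓝 0) := by
    have h2 : HasDerivAt (fun s : ℝ => 1 - Real.exp (-s)) 1 0 := by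
      simpa using ((hasDerivAt_neg (0 : ℝ)).exp).const_sub 1
    have h3 := h2.tendsto_slope_zero_right
    have h4 := (h3.log one_ne_zero).ofReal
    rw [Real.log_one, Complex.ofReal_zero] at h4
    refine h4.congr' ?_
    filter_upwards [self_mem_nhdsWithin] with s hs
    have hs0 : 0 < s := hs
    simp only [zero_add, neg_zero, Real.exp_zero, sub_self, sub_zero, smul_eq_mul]
    rw [Real.log_mul (inv_ne_zero hs0.ne') (one_sub_exp_neg_pos hs0).ne', Real.log_inv]
    congr 1
    ring
  -- The derivative formula `hh` holds only for s > 0, so the two primitives are compared on [ε, t]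
  -- and ε tends to 0.
  have hf0 : f 0 t = ((Real.log (1 - Real.exp (-t)) - Real.log t : ℝ) : ℂ) := by
    have h1 : Tendsto (fun ε : ℝ => f 0 t - f 0 ε) (𝓝[>] 0) (𝓝 (f 0 t - f 0 0)) :=
      ((hf 0 0).continuousAt.tendsto.mono_left nhdsWithin_le_nhds).const_sub _
    have h2 := hlim.const_sub ((Real.log (1 - Real.exp (-t)) - Real.log t : ℝ) : ℂ)
    have e : f 0 0 = 0 := by simp [f]
    rw [e, sub_zero] at h1
    rw [sub_zero] at h2
    refine tendsto_nhds_unique h1 (h2.congr' ?_)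
    filter_upwards [Ioo_mem_nhdsGT ht] with ε hε
    have hsub : ∀ s ∈ uIcc ε t, 0 < s := fun s hs => by
      rw [uIcc_of_le hε.2.le] at hs
      exact hε.1.trans_le hs.1
    rw [← intervalIntegral.integral_eq_sub_of_hasDerivAt (fun s hs => hh s (hsub s hs))
        (hDc.intervalIntegrable _ _),
      ← intervalIntegral.integral_eq_sub_of_hasDerivAt (fun s _ => hf 0 s)
        (by simpa [f] using hDc.intervalIntegrable _ _)]
    simp [f]
  have h := hC t ⟨ht.le, ht1⟩
  rw [hf0] at h
  have e : ∑ j ∈ Finset.range (n + 1), f j 0 * (t : ℂ) ^ j / (j.factorial : ℂ) =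
      ((∑ j ∈ Finset.range n, (bernoulli (j + 1) : ℝ) / (j + 1) * t ^ (j + 1) /
        ((j + 1).factorial : ℝ) : ℝ) : ℂ) := by
    rw [Finset.sum_range_succ']
    have e0 : f 0 0 = 0 := by simp [f]
    rw [e0]
    push_cast
    simp only [zero_mul, zero_div, add_zero]
    refine Finset.sum_congr rfl fun j _ => ?_
    have h1 := iteratedDeriv_dslope_zero (differentiableOn_bernoulliGen 0) j
    rw [iteratedDeriv_bernoulliGen, bernoulliFun_eval_zero] at h1
    have h3 : (j + 1 : ℂ) ≠ 0 := by exact_mod_cast j.succ_ne_zero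
    have h2 : f (j + 1) 0 = (bernoulli (j + 1) : ℂ) / (j + 1) := by
      rw [eq_div_iff h3, mul_comm]
      simpa [f] using h1
    rw [h2]
  rwa [e, ← Complex.ofReal_sub, Complex.norm_real, Real.norm_eq_abs] at h

open MeasureTheory Set in
/-- Euler–Maclaurin summation applied to the Binet kernel. -/
theorem sum_binetKernelReal_expansion {x : ℝ} (hx : 0 < x) (n : ℕ) :
    ∃ B : ℝ, ∀ t : ℝ, 0 < t →
      Summable (fun k : ℕ => binetKernelReal x (t * (k + 1))) ∧
      |t * (∑' k : ℕ, binetKernelReal x (t * (k + 1))) - binetIntegral x +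
        ∑ j ∈ Finset.range (n + 1), (bernoulli' (j + 1) : ℝ) / (j + 1) * t ^ (j + 1) *
          ((-1) ^ j * (bernoulliFun (j + 2) x / ((j + 2).factorial : ℝ) +
            (1 / 2 - x) / ((j + 1).factorial : ℝ)))| ≤ B * t ^ (n + 1) := by
  obtain ⟨B, hB⟩ := eulerMaclaurin_Ioi
    (f := fun j s => iteratedDeriv j (binetKernel x) (s : ℂ))
    (hasDerivAt_iteratedDeriv_ofReal (differentiableOn_binetKernel x))
    (norm_iteratedDeriv_binetKernel_le hx) n
  refine ⟨B, fun t ht => ?_⟩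
  obtain ⟨h1, h2⟩ := hB t ht
  have e1 : (fun k : ℕ => iteratedDeriv 0 (binetKernel x) ((t * (k + 1) : ℝ) : ℂ)) =
      fun k : ℕ => ((binetKernelReal x (t * (k + 1)) : ℝ) : ℂ) := by
    ext k
    rw [iteratedDeriv_zero, binetKernel_ofReal x (by positivity)]
  have e2 : ∫ s in Ioi (0 : ℝ), iteratedDeriv 0 (binetKernel x) (s : ℂ) =
      (binetIntegral x : ℂ) := by
    rw [binetIntegral, ← integral_complex_ofReal]
    refine setIntegral_congr_fun measurableSet_Ioi fun s hs => ?_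
    rw [iteratedDeriv_zero, binetKernel_ofReal x hs]
  rw [e1] at h1 h2
  refine ⟨Complex.summable_ofReal.1 h1, ?_⟩
  rw [e2, ← Complex.ofReal_tsum] at h2
  have e3 : ∑ j ∈ Finset.range (n + 1),
      (((bernoulli' (j + 1) : ℚ) : ℂ) / ((j + 1).factorial : ℂ)) * t ^ (j + 1) *
        iteratedDeriv j (binetKernel x) ((0 : ℝ) : ℂ) =
      ((∑ j ∈ Finset.range (n + 1), (bernoulli' (j + 1) : ℝ) / (j + 1) * t ^ (j + 1) *
          ((-1) ^ j * (bernoulliFun (j + 2) x / ((j + 2).factorial : ℝ) +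
            (1 / 2 - x) / ((j + 1).factorial : ℝ))) : ℝ) : ℂ) := by
    rw [Complex.ofReal_sum]
    refine Finset.sum_congr rfl fun j _ => ?_
    have h := iteratedDeriv_binetKernel x j
    have h5 : (j.factorial : ℂ) ≠ 0 := by exact_mod_cast j.factorial_ne_zero
    have h3 : (j + 1 : ℂ) ≠ 0 := by exact_mod_cast j.succ_ne_zero
    rw [div_eq_iff h5] at h
    rw [Complex.ofReal_zero, h, Nat.factorial_succ j]
    push_cast
    field_simp
  rw [e3] at h2
  rw [← Real.norm_eq_abs, ← Complex.norm_real]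
  push_cast at h2 ⊢
  exact h2

/-- Asymptotic expansion of the logarithm of `(e ^ (-x t), e ^ (-t))_∞` as `t → 0⁺`. -/
theorem log_qPochhammer_expansion {x : ℝ} (hx : 0 < x) (n : ℕ) :
    ∃ K : ℝ, ∀ t : ℝ, 0 < t → t ≤ 1 → ∃ L : ℝ,
      HasSum (fun m : ℕ => Real.log (1 - Real.exp (-((x + m) * t)))) L ∧
      |L - (-(Real.pi ^ 2 / 6 / t) + (1 / 2 - x) * Real.log t - Real.log (Real.Gamma x) +
        Real.log (2 * Real.pi) / 2 + ∑ j ∈ Finset.range n,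
          (-1) ^ j * ((bernoulli' (j + 1) : ℝ) / (j + 1)) *
            (bernoulliFun (j + 2) x / ((j + 2).factorial : ℝ)) * t ^ (j + 1))| ≤
        K * t ^ (n + 1) := by
  obtain ⟨B, hB⟩ := sum_binetKernelReal_expansion hx n
  obtain ⟨C, hC⟩ := log_one_sub_exp_neg_taylor n
  set c := 1 / 2 - x with hc
  set M : ℝ := (bernoulli' (n + 1) : ℝ) / (n + 1) *
          ((-1) ^ n * (bernoulliFun (n + 2) x / ((n + 2).factorial : ℝ) +
            c / ((n + 1).factorial : ℝ))) with hM
  -- M is the coefficient of the last Euler–Maclaurin term, of order t^(n+1), which is moved into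
  -- the error.
  refine ⟨|c| * C + B + |M|, fun t ht ht1 => ?_⟩
  obtain ⟨hs, hb⟩ := hB t ht
  have hh := hC t ht ht1
  refine ⟨_, hasSum_log_one_sub_exp hx ht hs, ?_⟩
  rw [Finset.sum_range_succ] at hb
  -- Since (-1)^j B'_{j+1} = -B_{j+1}, where B' and B are `bernoulli'` and `bernoulli`, the parts
  -- carrying 1/2 - x form -c times the Taylor polynomial of log((1 - e^(-t))/t) and will cancel
  -- against it.
  have e1 : ∑ j ∈ Finset.range n, (bernoulli' (j + 1) : ℝ) / (j + 1) * t ^ (j + 1) *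
          ((-1) ^ j * (bernoulliFun (j + 2) x / ((j + 2).factorial : ℝ) +
            c / ((j + 1).factorial : ℝ))) =
      ∑ j ∈ Finset.range n, (-1) ^ j * ((bernoulli' (j + 1) : ℝ) / (j + 1)) *
            (bernoulliFun (j + 2) x / ((j + 2).factorial : ℝ)) * t ^ (j + 1) -
      c * ∑ j ∈ Finset.range n, (bernoulli (j + 1) : ℝ) / (j + 1) * t ^ (j + 1) /
        ((j + 1).factorial : ℝ) := by
    rw [Finset.mul_sum, ← Finset.sum_sub_distrib]
    refine Finset.sum_congr rfl fun j _ => ?_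
    rw [bernoulli]
    push_cast
    ring
  rw [e1] at hb
  have hcH := mul_le_mul_of_nonneg_left hh (abs_nonneg c)
  rw [← abs_mul] at hcH
  have hMt : |M * t ^ (n + 1)| = |M| * t ^ (n + 1) := by
    rw [abs_mul, abs_of_pos (pow_pos ht _)]
  rw [binetIntegral_eq hx] at hb
  set A₁ := ∑ j ∈ Finset.range n, (-1) ^ j * ((bernoulli' (j + 1) : ℝ) / (j + 1)) *
            (bernoulliFun (j + 2) x / ((j + 2).factorial : ℝ)) * t ^ (j + 1)
  set A₂ := ∑ j ∈ Finset.range n, (bernoulli (j + 1) : ℝ) / (j + 1) * t ^ (j + 1) /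
        ((j + 1).factorial : ℝ)
  set T := t * ∑' k : ℕ, binetKernelReal x (t * (k + 1))
  set h := Real.log (1 - Real.exp (-t))
  rw [show (bernoulli' (n + 1) : ℝ) / (n + 1) * t ^ (n + 1) *
          ((-1) ^ n * (bernoulliFun (n + 2) x / ((n + 2).factorial : ℝ) +
            c / ((n + 1).factorial : ℝ))) = M * t ^ (n + 1) by rw [hM]; ring] at hb
  rw [show -(Real.pi ^ 2 / 6 / t) + c * h - T - (-(Real.pi ^ 2 / 6 / t) + c * Real.log t -
      Real.log (Real.Gamma x) + Real.log (2 * Real.pi) / 2 + A₁) =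
    c * (h - Real.log t - A₂) - (T - (Real.log (Real.Gamma x) - Real.log (2 * Real.pi) / 2) +
      (A₁ - c * A₂ + M * t ^ (n + 1))) + M * t ^ (n + 1) by ring]
  refine (abs_add_le _ _).trans ?_
  refine (add_le_add_left (abs_sub _ _) _).trans ?_
  rw [hMt]
  linarith

/-! ### Back to q: the truncated products and Watson's formula. -/

theorem prod_range_erase_one {f : ℕ → ℝ} (n : ℕ) :
    ∏ k ∈ (Finset.range (n + 2)).erase 1, f k = f 0 * ∏ j ∈ Finset.range n, f (j + 2) := by
  have e : (Finset.range (n + 2)).erase 1 =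
      insert 0 ((Finset.range n).map ⟨fun j => j + 2, add_left_injective 2⟩) := by
    ext k
    simp only [Finset.mem_erase, Finset.mem_range, Finset.mem_insert, Finset.mem_map,
      Function.Embedding.coeFn_mk]
    constructor
    · rintro ⟨h1, h2⟩
      rcases Nat.eq_zero_or_pos k with h | h
      · exact Or.inl h
      · exact Or.inr ⟨k - 2, by omega, by omega⟩
    · rintro (rfl | ⟨j, hj, rfl⟩) <;> omega
  rw [e, Finset.prod_insert (by simp), Finset.prod_map]
  rfl

theorem zetaInt_two_sub_zero : zetaInt (2 - ((0 : ℕ) : ℤ)) = Real.pi ^ 2 / 6 := by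
  have h := zetaInt_two_sub 0 (by norm_num)
  rw [Nat.cast_zero (R := ℂ), sub_zero, riemannZeta_two] at h
  exact_mod_cast h

/-- The convention `bernoulli'`, with value +1/2 at index 1, makes the formula for ζ(-j) uniform,
including ζ(0) = -1/2. -/
theorem zetaInt_two_sub_add_two (j : ℕ) :
    zetaInt (2 - ((j + 2 : ℕ) : ℤ)) = -((bernoulli' (j + 1) : ℝ) / (j + 1)) := by
  have h := zetaInt_two_sub (j + 2) (by omega)
  have e : (2 : ℂ) - ((j + 2 : ℕ) : ℂ) = -(j : ℂ) := by
    push_cast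
    ring
  rw [e, riemannZeta_neg_nat_eq_bernoulli', neg_div] at h
  exact_mod_cast h

/-- The truncated expansion is the exponential of the truncated expansion of the logarithm. -/
theorem qPochhammerExpansion_exp_neg {x t : ℝ} (hx : 0 < x) (ht : 0 < t) (n : ℕ) :
    qPochhammerExpansion (n + 1) x (Real.exp (-t)) =
      Real.exp (-(Real.pi ^ 2 / 6 / t) + (1 / 2 - x) * Real.log t - Real.log (Real.Gamma x) +
        Real.log (2 * Real.pi) / 2 + ∑ j ∈ Finset.range n,
          (-1) ^ j * ((bernoulli' (j + 1) : ℝ) / (j + 1)) *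
            (bernoulliFun (j + 2) x / ((j + 2).factorial : ℝ)) * t ^ (j + 1)) := by
  have hlog : Real.log (1 / Real.exp (-t)) = t := by
    rw [one_div, Real.log_inv, Real.log_exp, neg_neg]
  rw [qPochhammerExpansion, hlog, prod_range_erase_one, ← Real.exp_sum, Real.log_exp,
    zetaInt_two_sub_zero, Real.rpow_def_of_pos ht, Real.sqrt_eq_rpow,
    Real.rpow_def_of_pos Real.two_pi_pos, ← Real.exp_add]
  nth_rewrite 1 [← Real.exp_log (Real.Gamma_pos_of_pos hx)]
  rw [← Real.exp_sub, ← Real.exp_add, ← Real.exp_add]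
  congr 1
  have e : ∑ j ∈ Finset.range n, zetaInt (2 - ((j + 2 : ℕ) : ℤ)) / ((j + 2).factorial : ℝ) *
      bernoulliFun (j + 2) x * (-t) ^ (((j + 2 : ℕ) : ℤ) - 1) =
      ∑ j ∈ Finset.range n, (-1) ^ j * ((bernoulli' (j + 1) : ℝ) / (j + 1)) *
            (bernoulliFun (j + 2) x / ((j + 2).factorial : ℝ)) * t ^ (j + 1) := by
    refine Finset.sum_congr rfl fun j _ => ?_
    have h1 : ((j + 2 : ℕ) : ℤ) - 1 = ((j + 1 : ℕ) : ℤ) := by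
      push_cast
      ring
    rw [zetaInt_two_sub_add_two, h1, zpow_natCast, neg_pow t, pow_succ (-1 : ℝ) j]
    ring
  rw [e]
  simp only [Nat.factorial_zero, Nat.cast_one, Nat.cast_zero, bernoulliFun_zero, zero_sub,
    zpow_neg_one]
  field_simp
  ring

theorem one_sub_rpow_mul_pow {x q : ℝ} (hq : 0 < q) (n : ℕ) :
    1 - q ^ x * q ^ n = 1 - Real.exp (-((x + n) * -Real.log q)) := by
  rw [← Real.rpow_natCast, ← Real.rpow_add hq, Real.rpow_def_of_pos hq]
  ring_nf

theorem rpow_mul_pow_lt_one {x q : ℝ} (hx : 0 < x) (hq : 0 < q) (hq1 : q < 1) (n : ℕ) :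
    0 < 1 - q ^ x * q ^ n := by
  have h := Real.log_neg hq hq1
  rw [one_sub_rpow_mul_pow hq]
  exact one_sub_exp_neg_pos (by
    have : 0 < -Real.log q := by linarith
    positivity)

theorem multipliable_qPochhammer {x q : ℝ} (hx : 0 < x) (hq : 0 < q) (hq1 : q < 1) :
    Multipliable (fun n : ℕ => 1 - q ^ x * q ^ n) := by
  have hlog := Real.log_neg hq hq1
  have ht : 0 < -Real.log q := by linarith
  obtain ⟨B, hB⟩ := sum_binetKernelReal_expansion hx 0
  have h := hasSum_log_one_sub_exp hx ht (hB _ ht).1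
  simp only [← one_sub_rpow_mul_pow hq] at h
  exact (Real.hasProd_of_hasSum_log (rpow_mul_pow_lt_one hx hq hq1) h).multipliable

theorem qPochhammer_div_expansion_succ {x : ℝ} (hx : 0 < x) (n : ℕ) :
    (fun q : ℝ => qPochhammer (q ^ x) q / qPochhammerExpansion (n + 1) x q - 1)
      =O[𝓝[<] (1 : ℝ)] (fun q : ℝ => Real.log q ^ (n + 1)) := by
  obtain ⟨K, hK⟩ := log_qPochhammer_expansion hx n
  have hlim : Tendsto (fun q : ℝ => K * (-Real.log q) ^ (n + 1)) (𝓝[<] 1) (𝓝 0) := by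
    have h : ContinuousAt (fun q : ℝ => K * (-Real.log q) ^ (n + 1)) 1 := by
      fun_prop (disch := norm_num)
    simpa using h.tendsto.mono_left nhdsWithin_le_nhds
  -- The ratio is e^u with |u| ≤ K t^(n+1), t = -log q; once this bound is at most 1, |e^u - 1| ≤
  -- 2|u|. Restricting to q > e^(-1) ensures t < 1.
  refine IsBigO.of_bound (2 * K) ?_
  filter_upwards [Ioo_mem_nhdsLT (Real.exp_lt_one_iff.2 neg_one_lt_zero),
    hlim.eventually_le_const one_pos] with q hq hK1
  have hq0 : 0 < q := (Real.exp_pos _).trans hq.1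
  have hl1 : -1 < Real.log q := (Real.lt_log_iff_exp_lt hq0).2 hq.1
  have hl0 := Real.log_neg hq0 hq.2
  have ht : 0 < -Real.log q := by linarith
  obtain ⟨L, hL, hLb⟩ := hK (-Real.log q) ht (by linarith)
  simp only [← one_sub_rpow_mul_pow hq0] at hL
  have hP : qPochhammer (q ^ x) q = Real.exp L :=
    (Real.hasProd_of_hasSum_log (rpow_mul_pow_lt_one hx hq0 hq.2) hL).tprod_eq
  have hE := qPochhammerExpansion_exp_neg hx ht n
  rw [neg_neg, Real.exp_log hq0] at hE
  rw [hP, hE, ← Real.exp_sub]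
  have h := Real.abs_exp_sub_one_le (hLb.trans hK1)
  rw [Real.norm_eq_abs, norm_pow, Real.norm_eq_abs, abs_of_neg hl0]
  linarith

theorem log_pow_isBigO_of_le {m n : ℕ} (h : m ≤ n) :
    (fun q : ℝ => Real.log q ^ n) =O[𝓝[<] (1 : ℝ)] (fun q : ℝ => Real.log q ^ m) := by
  have hlim : Tendsto Real.log (𝓝[<] 1) (𝓝 0) := by
    have h := (Real.continuousAt_log (one_ne_zero)).tendsto
    rw [Real.log_one] at h
    exact h.mono_left nhdsWithin_le_nhds
  refine IsBigO.of_bound 1 ?_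
  filter_upwards [hlim.norm.eventually_le_const (by simp : ‖(0 : ℝ)‖ < 1)] with q hq
  rw [norm_pow, norm_pow, one_mul]
  exact pow_le_pow_of_le_one (norm_nonneg _) hq h

theorem qPochhammer_div_expansion {x : ℝ} (hx : 0 < x) (N : ℕ) :
    (fun q : ℝ => qPochhammer (q ^ x) q / qPochhammerExpansion N x q - 1)
      =O[𝓝[<] (1 : ℝ)] (fun q : ℝ => Real.log q ^ N) := by
  cases N with
  | zero =>
    -- The index k = 1 is excluded from the product, so truncating at 0 or at 1 is the same.
    have e : qPochhammerExpansion 0 x = qPochhammerExpansion 1 x := by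
      ext q
      rw [qPochhammerExpansion, qPochhammerExpansion]
      rfl
    rw [e]
    exact (qPochhammer_div_expansion_succ hx 0).trans (log_pow_isBigO_of_le (Nat.zero_le _))
  | succ n => exact qPochhammer_div_expansion_succ hx n

/-- All factors with k ≥ 3 are trivial: B_k(1) = 0 for odd k, and for even k the number 2 - k is a
trivial zero of ζ. The factors k = 0 and k = 2 give e^(π²/(6 log q)) and q^(-1/24). -/
theorem qPochhammerExpansion_one_eq_watsonApprox {q : ℝ} (hq : 0 < q) (hq1 : q < 1) (n : ℕ) :
    qPochhammerExpansion (n + 2) 1 q = watsonApprox q := by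
  have hl := Real.log_neg hq hq1
  have hl' : Real.log (1 / q) = -Real.log q := by rw [one_div, Real.log_inv]
  have ht : 0 < -Real.log q := by linarith
  rw [qPochhammerExpansion, prod_range_erase_one, Finset.prod_range_succ', Finset.prod_eq_one,
    watsonApprox, hl', zetaInt_two_sub_zero, zetaInt_two_sub_add_two, Real.Gamma_one, one_mul,
    div_one, Real.sqrt_div Real.two_pi_pos.le, div_eq_mul_inv (Real.sqrt (2 * Real.pi)),
    Real.sqrt_eq_rpow (-Real.log q), ← Real.rpow_neg ht.le, Real.rpow_def_of_pos hq, ← mul_assoc]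
  · have e0 : Real.pi ^ 2 / 6 / ((0 : ℕ).factorial : ℝ) * bernoulliFun 0 1 *
        Real.log q ^ (((0 : ℕ) : ℤ) - 1) = Real.pi ^ 2 / (6 * Real.log q) := by
      simp
      field_simp
    have e2 : -((bernoulli' (0 + 1) : ℝ) / ((0 : ℕ) + 1)) / ((0 + 2).factorial : ℝ) *
        bernoulliFun (0 + 2) 1 * Real.log q ^ (((0 + 2 : ℕ) : ℤ) - 1) =
        Real.log q * -(1 / 24) := by
      norm_num [bernoulliFun_two, Nat.factorial]
      ring
    rw [e0, e2]
    norm_num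
  · intro j _
    rw [zetaInt_two_sub_add_two]
    rcases Nat.even_or_odd j with hj | hj
    · have h3 : bernoulliFun (j + 1 + 2) 1 = 0 := by
        rw [bernoulliFun, Polynomial.eval_one_map, Polynomial.bernoulli_eval_one,
          bernoulli'_eq_zero_of_odd (by simpa [parity_simps] using hj) (by omega), map_zero]
      simp [h3]
    · rw [bernoulli'_eq_zero_of_odd (by simpa [parity_simps] using hj) (by omega)]
      simp

theorem qPochhammer_div_watsonApprox (N : ℕ) :
    (fun q : ℝ => qPochhammer q q / watsonApprox q - 1)
      =O[𝓝[<] (1 : ℝ)] (fun q : ℝ => Real.log q ^ N) := by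
  refine (((qPochhammer_div_expansion one_pos (N + 2)).congr' ?_ EventuallyEq.rfl).trans
    (log_pow_isBigO_of_le (by omega)))
  filter_upwards [Ioo_mem_nhdsLT one_pos] with q hq
  rw [qPochhammerExpansion_one_eq_watsonApprox hq.1 hq.2, Real.rpow_one]

theorem mainTheorem2 :
    (∀ x : ℝ, 0 < x →
      (∀ q : ℝ, 0 < q → q < 1 → Multipliable (fun n : ℕ => 1 - q ^ x * q ^ n)) ∧
      (∀ N : ℕ,
        (fun q : ℝ => qPochhammer (q ^ x) q / qPochhammerExpansion N x q - 1)
          =O[𝓝[<] (1 : ℝ)] (fun q : ℝ => Real.log q ^ N))) ∧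
    ((fun q : ℝ => qPochhammer q q) ~[𝓝[<] (1 : ℝ)] watsonApprox) ∧
    (∀ N : ℕ,
      (fun q : ℝ => qPochhammer q q / watsonApprox q - 1)
        =O[𝓝[<] (1 : ℝ)] (fun q : ℝ => Real.log q ^ N)) := by
  refine ⟨fun x hx => ⟨fun q hq hq1 => multipliable_qPochhammer hx hq hq1,
    qPochhammer_div_expansion hx⟩, ?_, qPochhammer_div_watsonApprox⟩
  have hne : ∀ᶠ q in 𝓝[<] (1 : ℝ), watsonApprox q ≠ 0 := by
    filter_upwards [Ioo_mem_nhdsLT one_pos] with q hq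
    have hl : 0 < Real.log (1 / q) := Real.log_pos (one_lt_one_div hq.1 hq.2)
    have := hq.1
    unfold watsonApprox
    positivity
  rw [isEquivalent_iff_tendsto_one hne]
  have h := (qPochhammer_div_watsonApprox 1).trans_tendsto (by
    have h := (Real.continuousAt_log (one_ne_zero)).tendsto
    rw [Real.log_one] at h
    simpa using h.mono_left nhdsWithin_le_nhds)
  simpa [Pi.div_def] using h.add_const 1
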